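/- **Setting.** Let $M$ be an $n$-dimensional manifold. A Kundt$^\infty$ triple on $M$ is a triple $(H,W,h)$ of a smooth function $H$, a smooth one-form $W$ and a Riemannian metric $h$ on $M$; it is *locally homogeneous* if the Lorentzian metric $2\,du\,(dv+v^2H\,du+vW)+h$ on $\mathbb R^2\times M$ is locally homogeneous. Put $\sigma=2H-\tfrac14\|W\|^2$ and, with $[\;]$ and $(\;)$ denoting (anti)symmetrization including the factor $\tfrac12$ and with the Riemann tensor normalized by $W_{i;jk}-W_{i;kj}=W^lR_{lijk}$, $$a_{ij}=W_{[i;j]},\qquad s_{ij}=W_{(i;j)}-\tfrac12W_iW_j,\qquad \alpha_i=\sigma W_i-\tfrac12(s_{ij}+a_{ij})W^j,$$ $$\beta_{ijk}=W^lR_{lijk}-W_ia_{jk}+(s_{i[j}+a_{i[j})W_{k]}.$$ Near a point $p$ consider the Killing vector fields $\xi$ of $h$ that leave $a,s,\alpha,\beta$ invariant. Let $I^1=\{\mathcal L_\xi W\}$, $I^{r+1}=\{\mathcal L_\xi w: w\in I^r\}$, with $\xi$ ranging over these fields, let $I^1|_p$ be the space of values at $p$ of elements of $I^1$, and let $\mathcal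 I_p$ be the span of the values at $p$ of the elements of all the $I^r$, $r\ge1$. **Theorem.** Let $(H,W,h)$ be a locally homogeneous Kundt$^\infty$ triple on a connected product coordinate domain with coordinates $(x^C,x^{\hat c})$, $C\in[1,m]$, $\hat c\in[m+1,n]$, such that at every point $p$ one has $\dim I^1|_p=m$ and $0<\dim\mathcal I_p<n$. Suppose that the transverse space is a locally homogeneous warped product $$h=h_{AB}(x^C)\,dx^Adx^B+e^{2f(x^A)}h_{\hat a\hat b}(x^{\hat c})\,dx^{\hat a}dx^{\hat b},$$ where $f$ is smooth, $h_{AB}$ is maximally symmetric (of constant curvature) and $h_{\hat a\hat b}$ is locally homogeneous, and that the splitting is adapted to the triple, i.e. $I^1|_p$ is spanned by the $dx^A$ at every $p$. Then there is a constant $S$ such that, at every point, $s_{\hat i\hat j}=S\,\delta_{\hat i\hat j}$ in every orthonormal frame $m_{\hat i}$ of the fibre directions, and, for every orthonormal frame $m_I$ of $h_{AB}$, $$-\bigl[\nabla_{m_K}m_I(f)+m_K(f)\,m_I(f)\bigr]=\tfrac12\,S\,\delta_{KI},$$ where $\nabla_{m_K}m_I(f)=m_K(m_I(f))-(\nabla_{m_K}m_I)(f)$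 is the Hessian of $f$ with respect to $h_{AB}$. -/

import Mathlib

open scoped ContDiff

noncomputable section

namespace KundtInfinity

variable {ι : Type} [Fintype ι] [DecidableEq ι]

/-! Tensor calculus in coordinates. A tensor field on an open subset of `ι → ℝ` is given by its
coordinate components. -/

/-- The partial derivative `∂_i F`. -/
def pd (i : ι) (F : (ι → ℝ) → ℝ) (x : ι → ℝ) : ℝ :=
  fderiv ℝ F x (Pi.single i 1)

/-- Christoffel symbols `Γ^k_{ij}` of the metric `g`. -/
def christoffel (g : (ι → ℝ) → Matrix ι ι ℝ) (x : ι → ℝ) (k i j : ι) : ℝ :=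
  (1 / 2) * ∑ l, (g x)⁻¹ k l *
    (pd i (fun y => g y l j) x + pd j (fun y => g y l i) x - pd l (fun y => g y i j) x)

/-- The covariant derivative `w_{i;j} = ∂_j w_i - Γ^k_{ij} w_k` of a one-form. -/
def covDeriv (g : (ι → ℝ) → Matrix ι ι ℝ) (w : (ι → ℝ) → ι → ℝ) (x : ι → ℝ) (i j : ι) : ℝ :=
  pd j (fun y => w y i) x - ∑ k, christoffel g x k i j * w x k

/-- The Hessian `F_{;ij}` of a function. -/
def hessian (g : (ι → ℝ) → Matrix ι ι ℝ) (F : (ι → ℝ) → ℝ) (x : ι → ℝ) (i j : ι) : ℝ :=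
  covDeriv g (fun y a => pd a F y) x i j

/-- The Riemann tensor `R^l_{ijk}`, with `w_{i;jk} - w_{i;kj} = R^l_{ijk} w_l`. -/
def riemannUp (g : (ι → ℝ) → Matrix ι ι ℝ) (x : ι → ℝ) (l i j k : ι) : ℝ :=
  pd j (fun y => christoffel g y l k i) x - pd k (fun y => christoffel g y l j i) x
    + ∑ p, (christoffel g x l j p * christoffel g x p k i
      - christoffel g x l k p * christoffel g x p j i)

/-- The Riemann tensor `R_{nijk}` with all indices down. -/
def riemann (g : (ι → ℝ) → Matrix ι ι ℝ) (x : ι → ℝ) (n i j k : ι) : ℝ :=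
  ∑ l, g x n l * riemannUp g x l i j k

/-- The Lie derivative of a one-form. -/
def lie1 (ξ : (ι → ℝ) → ι → ℝ) (w : (ι → ℝ) → ι → ℝ) (x : ι → ℝ) (i : ι) : ℝ :=
  ∑ l, (ξ x l * pd l (fun y => w y i) x + w x l * pd i (fun y => ξ y l) x)

/-- The Lie derivative of a covariant 2-tensor. -/
def lie2 (ξ : (ι → ℝ) → ι → ℝ) (T : (ι → ℝ) → ι → ι → ℝ) (x : ι → ℝ) (i j : ι) : ℝ :=
  ∑ l, (ξ x l * pd l (fun y => T y i j) x
    + T x l j * pd i (fun y => ξ y l) x + T x i l * pd j (fun y => ξ y l) x)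

/-- The Lie derivative of a covariant 3-tensor. -/
def lie3 (ξ : (ι → ℝ) → ι → ℝ) (T : (ι → ℝ) → ι → ι → ι → ℝ) (x : ι → ℝ) (i j k : ι) : ℝ :=
  ∑ l, (ξ x l * pd l (fun y => T y i j k) x
    + T x l j k * pd i (fun y => ξ y l) x + T x i l k * pd j (fun y => ξ y l) x
    + T x i j l * pd k (fun y => ξ y l) x)

/-- `h` is a smooth Riemannian metric on `U`. -/
def IsRiemannianOn (h : (ι → ℝ) → Matrix ι ι ℝ) (U : Set (ι → ℝ)) : Prop :=
  (∀ i j, ContDiffOn ℝ ∞ (fun x => h x i j) U) ∧ ∀ x ∈ U, (h x).PosDef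

/-- The (pseudo-)Riemannian metric `g` on the open set `U` is locally homogeneous: any point of `U`
can be carried to any other one by an isometry between open subsets of `U`. -/
def LocallyHomogeneousOn (g : (ι → ℝ) → Matrix ι ι ℝ) (U : Set (ι → ℝ)) : Prop :=
  ∀ p ∈ U, ∀ q ∈ U, ∃ φ : OpenPartialHomeomorph (ι → ℝ) (ι → ℝ),
    p ∈ φ.source ∧ φ.source ⊆ U ∧ φ.target ⊆ U ∧ φ p = q ∧
    ContDiffOn ℝ ∞ φ φ.source ∧ ContDiffOn ℝ ∞ φ.symm φ.target ∧
    ∀ x ∈ φ.source, ∀ i j, g x i j =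
      ∑ a, ∑ b, g (φ x) a b * pd i (fun y => φ y a) x * pd j (fun y => φ y b) x

/-- The Riemannian metric `h` is (locally) maximally symmetric on `U`, i.e. of constant
curvature. -/
def MaximallySymmetricOn (h : (ι → ℝ) → Matrix ι ι ℝ) (U : Set (ι → ℝ)) : Prop :=
  ∃ κ : ℝ, ∀ x ∈ U, ∀ i j k l,
    riemann h x i j k l = κ * (h x i k * h x j l - h x i l * h x j k)

/-- The vectors `e I` form an orthonormal frame for the inner product with matrix `G`. -/
def IsOrthonormalFrame (G : Matrix ι ι ℝ) (e : ι → ι → ℝ) : Prop :=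
  ∀ I J, ∑ a, ∑ b, G a b * e I a * e J b = if I = J then 1 else 0

/-- A Kundt^∞ triple `(H, W, h)` on `U`: a function, a one-form and a Riemannian metric. -/
structure KundtTriple (U : Set (ι → ℝ)) where
  H : (ι → ℝ) → ℝ
  W : (ι → ℝ) → ι → ℝ
  h : (ι → ℝ) → Matrix ι ι ℝ
  smooth_H : ContDiffOn ℝ ∞ H U
  smooth_W : ∀ i, ContDiffOn ℝ ∞ (fun x => W x i) U
  riemannian : IsRiemannianOn h U

namespace KundtTriple

variable {U : Set (ι → ℝ)} (T : KundtTriple U)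

/-- The Kundt^∞ metric `2 du (dv + v² H du + v W) + h`, in the coordinates
`u = x (inl 0)`, `v = x (inl 1)`, `x^i = x (inr i)`. -/
def metric (x : Fin 2 ⊕ ι → ℝ) : Matrix (Fin 2 ⊕ ι) (Fin 2 ⊕ ι) ℝ :=
  let v : ℝ := x (Sum.inl 1)
  let y : ι → ℝ := fun i => x (Sum.inr i)
  Matrix.fromBlocks
    !![2 * v ^ 2 * T.H y, 1; 1, 0]
    (Matrix.of ![fun i => v * T.W y i, fun _ => 0])
    (Matrix.of fun i => ![v * T.W y i, 0])
    (T.h y)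

/-- The triple is locally homogeneous: its Kundt^∞ metric on `ℝ² × U` is. -/
def LocallyHomogeneous : Prop :=
  LocallyHomogeneousOn T.metric {x | (fun i => x (Sum.inr i)) ∈ U}

/-- `W^i`. -/
def WUp (x : ι → ℝ) (i : ι) : ℝ := ∑ j, (T.h x)⁻¹ i j * T.W x j

/-- `σ`, defined by `H = σ/2 + ‖W‖²/8`. -/
def sigma (x : ι → ℝ) : ℝ := 2 * T.H x - (1 / 4) * ∑ i, T.W x i * T.WUp x i

/-- `a_{ij} = W_{[i;j]}`. -/
def a (x : ι → ℝ) (i j : ι) : ℝ :=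
  (1 / 2) * (covDeriv T.h T.W x i j - covDeriv T.h T.W x j i)

/-- `s_{ij} = W_{(i;j)} - W_i W_j / 2`. -/
def s (x : ι → ℝ) (i j : ι) : ℝ :=
  (1 / 2) * (covDeriv T.h T.W x i j + covDeriv T.h T.W x j i) - (1 / 2) * T.W x i * T.W x j

/-- `α_i = σ W_i - (s_{ij} + a_{ij}) W^j / 2`. -/
def alpha (x : ι → ℝ) (i : ι) : ℝ :=
  T.sigma x * T.W x i - (1 / 2) * ∑ j, (T.s x i j + T.a x i j) * T.WUp x j

/-- `β_{ijk} = W^n R_{nijk} - W_i a_{jk} + (s_{i[j} + a_{i[j}) W_{k]}`. -/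
def beta (x : ι → ℝ) (i j k : ι) : ℝ :=
  ∑ n, T.WUp x n * riemann T.h x n i j k - T.W x i * T.a x j k
    + (1 / 2) * ((T.s x i j + T.a x i j) * T.W x k - (T.s x i k + T.a x i k) * T.W x j)

/-- `ξ` is a Killing vector field of `h` on `O` under which the tensors
`a`, `s`, `α`, `β` are invariant. -/
def IsInvariantKilling (O : Set (ι → ℝ)) (ξ : (ι → ℝ) → ι → ℝ) : Prop :=
  (∀ i, ContDiffOn ℝ ∞ (fun x => ξ x i) O) ∧
  ∀ x ∈ O,
    (∀ i j, lie2 ξ (fun y => T.h y) x i j = 0) ∧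
    (∀ i j, lie2 ξ T.a x i j = 0) ∧
    (∀ i j, lie2 ξ T.s x i j = 0) ∧
    (∀ i, lie1 ξ T.alpha x i = 0) ∧
    (∀ i j k, lie3 ξ T.beta x i j k = 0)

/-- The iterated Lie derivatives of `W` on `O`: `iterLie O r` is the set `I^{r+1}`. -/
def iterLie (O : Set (ι → ℝ)) : ℕ → Set ((ι → ℝ) → ι → ℝ)
  | 0 => {v | ∃ ξ, T.IsInvariantKilling O ξ ∧ v = lie1 ξ T.W}
  | r + 1 => {v | ∃ ξ, T.IsInvariantKilling O ξ ∧ ∃ w ∈ iterLie O r, v = lie1 ξ w}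

/-- The values at `p` of the elements of `I^{r+1}`, formed with Killing fields near `p`. -/
def valuesAt (r : ℕ) (p : ι → ℝ) : Set (ι → ℝ) :=
  {c | ∃ O : Set (ι → ℝ), IsOpen O ∧ p ∈ O ∧ O ⊆ U ∧ ∃ v ∈ T.iterLie O r, c = v p}

/-- The space `I^1|_p`. -/
def I1 (p : ι → ℝ) : Submodule ℝ (ι → ℝ) := Submodule.span ℝ (T.valuesAt 0 p)

/-- The space `𝓘_p` spanned by all the `I^r|_p`, `r ≥ 1`. -/
def calI (p : ι → ℝ) : Submodule ℝ (ι → ℝ) := Submodule.span ℝ (⋃ r, T.valuesAt r p)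

end KundtTriple

/-- The first `m` coordinates `x^A`. -/
def basePt {m k : ℕ} (x : Fin m ⊕ Fin k → ℝ) : Fin m → ℝ := fun A => x (Sum.inl A)

/-- The last `k` coordinates. -/
def fiberPt {m k : ℕ} (x : Fin m ⊕ Fin k → ℝ) : Fin k → ℝ := fun c => x (Sum.inr c)

/-- The coordinate domain `B × V`. -/
def productDomain {m k : ℕ} (B : Set (Fin m → ℝ)) (V : Set (Fin k → ℝ)) :
    Set (Fin m ⊕ Fin k → ℝ) :=
  {x | basePt x ∈ B ∧ fiberPt x ∈ V}

/-- The warped product metric `hB_{AB}(x^C) dx^A dx^B + e^{2 f(x^A)} hF_{ab}(x^c) dx^a dx^b`. -/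
def warpedMetric {m k : ℕ} (hB : (Fin m → ℝ) → Matrix (Fin m) (Fin m) ℝ)
    (hF : (Fin k → ℝ) → Matrix (Fin k) (Fin k) ℝ) (f : (Fin m → ℝ) → ℝ)
    (x : Fin m ⊕ Fin k → ℝ) : Matrix (Fin m ⊕ Fin k) (Fin m ⊕ Fin k) ℝ :=
  Matrix.fromBlocks (hB (basePt x)) 0 0 (Real.exp (2 * f (basePt x)) • hF (fiberPt x))

end KundtInfinity

end

/-!
Every covector field `w = L_ξ W` in `I^1` inherits two differential conditions from the invariance
of `a` and `s`. The antisymmetric part of `∇W` is `± dW / 2`, so invariance of `a` makes `w` closed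
(`lie1_closed`). The symmetric part of `∇W` is `L_X h / 2` with `X = W^♯` (`covDeriv_add_swap`), and
since `ξ` is Killing, `w` is dual to `Y = [ξ, X]` (`metric_mul_bracket`) and `L_ξ L_X h = L_Y h`
(`lie2_lie2_sub`). Invariance of `s` therefore reads `L_Y h = w ⊗ W + W ⊗ w` (`lie2_bracket`), that
is, `w_{(i;j)} = w_{(i} W_{j)}`. Working with `L_X h` instead of Christoffel symbols avoids showing
separately that Killing fields preserve the connection.

The splitting is adapted, so `w` has no fibre components and `Y` is tangent to the base. In the
warped product the equation for `L_Y h` then splits as follows.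

* Fibre components: the left-hand side is `2 Y(f) h_{ab}` (`lie2_warped_fiber`), the right-hand side
  is zero, so `Y(f) = 0`. By the dimension hypothesis `w` ranges over all the covectors of the base,
  hence `df = 0` (`pd_warping_eq_zero`).
* Mixed components: the left-hand side is `∂_b w_A` (`lie2_warped_mixed`), which is `∂_A w_b = 0`
  as `w` is closed; so `w_A W_b = 0`, hence `W_b = 0` (`W_fiber_eq_zero`).

With `W` and `X` tangent to the base and `df = 0`, the same fibre formula gives `s_{ab} = 0`
(`s_fiber_eq_zero`), and the Hessian of `f` vanishes. So the constant `S` is zero, and no other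
value is possible: the bounds on `dim 𝓘_p` force both factors to have positive dimension
(`calI_eq_bot` for the base), and a positive-dimensional factor determines `S`.

The hypotheses are satisfiable. An example is the product of three-dimensional anti-de Sitter space
with a Euclidean space: `h` is flat, `W = -2 tanh x dx`, `2 H = -1 / cosh² x`, with the line `x` as
base; here `I^1` is spanned by `∂_x W = -2 dx / cosh² x`.
-/

namespace KundtInfinity

section Calculus

/-! ### Partial derivatives -/

theorem differentiableAt_of_smooth {ι : Type} [Fintype ι] {O : Set (ι → ℝ)}
    {F : (ι → ℝ) → ℝ} {x : ι → ℝ} (hO : IsOpen O) (hF : ContDiffOn ℝ ∞ F O) (hx : x ∈ O) :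
    DifferentiableAt ℝ F x :=
  (hF.contDiffAt (hO.mem_nhds hx)).differentiableAt (by simp)

theorem pd_congr {ι : Type} [DecidableEq ι] {O : Set (ι → ℝ)} {F G : (ι → ℝ) → ℝ} {x : ι → ℝ}
    (hO : IsOpen O) (hx : x ∈ O) (h : ∀ y ∈ O, F y = G y) (i : ι) :
    pd i F x = pd i G x := by
  have : F =ᶠ[nhds x] G := Filter.eventuallyEq_of_mem (hO.mem_nhds hx) h
  rw [pd, pd, this.fderiv_eq]

theorem pd_eq_zero {ι : Type} [DecidableEq ι] {O : Set (ι → ℝ)} {F : (ι → ℝ) → ℝ} {x : ι → ℝ}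
    (hO : IsOpen O) (hx : x ∈ O) (h : ∀ y ∈ O, F y = 0) (i : ι) :
    pd i F x = 0 := by
  rw [pd_congr (G := fun _ => 0) hO hx h i]
  simp [pd]

/-- Two double sums agree when their summands do after symmetrization in the two indices; this
spares renaming dummy indices in the bracket identities below. -/
theorem sum_sum_eq_of_swap {ι : Type} [Fintype ι] {F G : ι → ι → ℝ}
    (h : ∀ m l, F m l + F l m = G m l + G l m) :
    ∑ m, ∑ l, F m l = ∑ m, ∑ l, G m l := by
  have hF : ∑ m, ∑ l, (F m l + F l m) = 2 * ∑ m, ∑ l, F m l := by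
    simp only [Finset.sum_add_distrib]
    rw [Finset.sum_comm (f := fun m l => F l m)]; ring
  have hG : ∑ m, ∑ l, (G m l + G l m) = 2 * ∑ m, ∑ l, G m l := by
    simp only [Finset.sum_add_distrib]
    rw [Finset.sum_comm (f := fun m l => G l m)]; ring
  simp only [h] at hF
  linarith
variable {ι : Type} [Fintype ι] [DecidableEq ι] {O : Set (ι → ℝ)} {F G : (ι → ℝ) → ℝ} {x : ι → ℝ}

theorem smooth_pd (hO : IsOpen O) (hF : ContDiffOn ℝ ∞ F O) (i : ι) :
    ContDiffOn ℝ ∞ (fun y => pd i F y) O :=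
  (hF.fderiv_of_isOpen hO (m := ∞) (by simp)).clm_apply contDiffOn_const

theorem pd_add (hF : DifferentiableAt ℝ F x) (hG : DifferentiableAt ℝ G x) (i : ι) :
    pd i (fun y => F y + G y) x = pd i F x + pd i G x := by
  simp [pd, fderiv_fun_add hF hG]

theorem pd_sub (hF : DifferentiableAt ℝ F x) (hG : DifferentiableAt ℝ G x) (i : ι) :
    pd i (fun y => F y - G y) x = pd i F x - pd i G x := by
  simp [pd, fderiv_fun_sub hF hG]

theorem pd_mul (hF : DifferentiableAt ℝ F x) (hG : DifferentiableAt ℝ G x) (i : ι) :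
    pd i (fun y => F y * G y) x = pd i F x * G x + F x * pd i G x := by
  simp [pd, fderiv_fun_mul hF hG]; ring

theorem pd_const_mul (c : ℝ) (hF : DifferentiableAt ℝ F x) (i : ι) :
    pd i (fun y => c * F y) x = c * pd i F x := by
  simp [pd, fderiv_const_mul hF c]

theorem pd_sum {κ : Type} (s : Finset κ) {f : κ → (ι → ℝ) → ℝ}
    (hf : ∀ l ∈ s, DifferentiableAt ℝ (f l) x) (i : ι) :
    pd i (fun y => ∑ l ∈ s, f l y) x = ∑ l ∈ s, pd i (f l) x := by
  simp [pd, fderiv_fun_sum hf]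

theorem pd_comm (hO : IsOpen O) (hF : ContDiffOn ℝ ∞ F O) (hx : x ∈ O) (i j : ι) :
    pd i (fun y => pd j F y) x = pd j (fun y => pd i F y) x := by
  have hd : DifferentiableAt ℝ (fderiv ℝ F) x :=
    ((hF.fderiv_of_isOpen hO (m := ∞) (by simp)).contDiffAt (hO.mem_nhds hx)).differentiableAt
      (by simp)
  have hs : IsSymmSndFDerivAt ℝ F x :=
    (hF.contDiffAt (hO.mem_nhds hx)).isSymmSndFDerivAt (by
      rw [minSmoothness_of_isRCLikeNormedField]
      exact WithTop.coe_le_coe.2 (le_top : (2 : ℕ∞) ≤ ⊤))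
  simp only [pd]
  rw [fderiv_clm_apply hd (differentiableAt_const _),
    fderiv_clm_apply hd (differentiableAt_const _)]
  simpa using hs (Pi.single i 1) (Pi.single j 1)

/-! ### Lie derivatives and brackets -/

/-- The Lie bracket `[ξ, X]` of two vector fields in coordinates. -/
noncomputable def bracket (ξ X : (ι → ℝ) → ι → ℝ) (x : ι → ℝ) (l : ι) : ℝ :=
  ∑ m, (ξ x m * pd m (fun y => X y l) x - X x m * pd m (fun y => ξ y l) x)

variable {ξ X W : (ι → ℝ) → ι → ℝ} {T : (ι → ℝ) → ι → ι → ℝ}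

theorem smooth_lie2 (hO : IsOpen O) (hξ : ∀ i, ContDiffOn ℝ ∞ (fun y => ξ y i) O)
    (hT : ∀ i j, ContDiffOn ℝ ∞ (fun y => T y i j) O) (i j : ι) :
    ContDiffOn ℝ ∞ (fun y => lie2 ξ T y i j) O :=
  ContDiffOn.sum fun l _ => (((hξ l).mul (smooth_pd hO (hT i j) l)).add
    ((hT l j).mul (smooth_pd hO (hξ l) i))).add ((hT i l).mul (smooth_pd hO (hξ l) j))

theorem pd_lie1 (hO : IsOpen O) (hξ : ∀ i, ContDiffOn ℝ ∞ (fun y => ξ y i) O)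
    (hW : ∀ i, ContDiffOn ℝ ∞ (fun y => W y i) O) (hx : x ∈ O) (m i : ι) :
    pd m (fun y => lie1 ξ W y i) x = ∑ l,
      (pd m (fun y => ξ y l) x * pd l (fun y => W y i) x
        + ξ x l * pd m (fun y => pd l (fun z => W z i) y) x
        + (pd m (fun y => W y l) x * pd i (fun y => ξ y l) x
        + W x l * pd m (fun y => pd i (fun z => ξ z l) y) x)) := by
  have d {F : (ι → ℝ) → ℝ} (hF : ContDiffOn ℝ ∞ F O) : DifferentiableAt ℝ F x :=
    differentiableAt_of_smooth hO hF hx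
  simp only [lie1]
  rw [pd_sum _ fun l _ => ((d (hξ l)).fun_mul (d (smooth_pd hO (hW i) l))).fun_add
    ((d (hW l)).fun_mul (d (smooth_pd hO (hξ l) i)))]
  refine Finset.sum_congr rfl fun l _ => ?_
  rw [pd_add ((d (hξ l)).fun_mul (d (smooth_pd hO (hW i) l)))
    ((d (hW l)).fun_mul (d (smooth_pd hO (hξ l) i))),
    pd_mul (d (hξ l)) (d (smooth_pd hO (hW i) l)), pd_mul (d (hW l)) (d (smooth_pd hO (hξ l) i))]

theorem pd_lie2 (hO : IsOpen O) (hξ : ∀ i, ContDiffOn ℝ ∞ (fun y => ξ y i) O)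
    (hT : ∀ i j, ContDiffOn ℝ ∞ (fun y => T y i j) O) (hx : x ∈ O) (m i j : ι) :
    pd m (fun y => lie2 ξ T y i j) x = ∑ l,
      (pd m (fun y => ξ y l) x * pd l (fun y => T y i j) x
        + ξ x l * pd m (fun y => pd l (fun z => T z i j) y) x
        + (pd m (fun y => T y l j) x * pd i (fun y => ξ y l) x
        + T x l j * pd m (fun y => pd i (fun z => ξ z l) y) x)
        + (pd m (fun y => T y i l) x * pd j (fun y => ξ y l) x
        + T x i l * pd m (fun y => pd j (fun z => ξ z l) y) x)) := by
  have d {F : (ι → ℝ) → ℝ} (hF : ContDiffOn ℝ ∞ F O) : DifferentiableAt ℝ F x :=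
    differentiableAt_of_smooth hO hF hx
  have h1 l := (d (hξ l)).fun_mul (d (smooth_pd hO (hT i j) l))
  have h2 l := (d (hT l j)).fun_mul (d (smooth_pd hO (hξ l) i))
  have h3 l := (d (hT i l)).fun_mul (d (smooth_pd hO (hξ l) j))
  simp only [lie2]
  rw [pd_sum _ fun l _ => ((h1 l).fun_add (h2 l)).fun_add (h3 l)]
  refine Finset.sum_congr rfl fun l _ => ?_
  rw [pd_add ((h1 l).fun_add (h2 l)) (h3 l), pd_add (h1 l) (h2 l),
    pd_mul (d (hξ l)) (d (smooth_pd hO (hT i j) l)),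
    pd_mul (d (hT l j)) (d (smooth_pd hO (hξ l) i)),
    pd_mul (d (hT i l)) (d (smooth_pd hO (hξ l) j))]

theorem pd_bracket (hO : IsOpen O) (hξ : ∀ i, ContDiffOn ℝ ∞ (fun y => ξ y i) O)
    (hX : ∀ i, ContDiffOn ℝ ∞ (fun y => X y i) O) (hx : x ∈ O) (i l : ι) :
    pd i (fun y => bracket ξ X y l) x = ∑ m,
      (pd i (fun y => ξ y m) x * pd m (fun y => X y l) x
        + ξ x m * pd i (fun y => pd m (fun z => X z l) y) x
        - (pd i (fun y => X y m) x * pd m (fun y => ξ y l) x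
        + X x m * pd i (fun y => pd m (fun z => ξ z l) y) x)) := by
  have d {F : (ι → ℝ) → ℝ} (hF : ContDiffOn ℝ ∞ F O) : DifferentiableAt ℝ F x :=
    differentiableAt_of_smooth hO hF hx
  have h1 m := (d (hξ m)).fun_mul (d (smooth_pd hO (hX l) m))
  have h2 m := (d (hX m)).fun_mul (d (smooth_pd hO (hξ l) m))
  simp only [bracket]
  rw [pd_sum _ fun m _ => (h1 m).fun_sub (h2 m)]
  refine Finset.sum_congr rfl fun m _ => ?_
  rw [pd_sub (h1 m) (h2 m), pd_mul (d (hξ m)) (d (smooth_pd hO (hX l) m)),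
    pd_mul (d (hX m)) (d (smooth_pd hO (hξ l) m))]

/-- `L_ξ L_X - L_X L_ξ = L_[ξ, X]` on covariant 2-tensors. -/
theorem lie2_lie2_sub (hO : IsOpen O) (hξ : ∀ i, ContDiffOn ℝ ∞ (fun y => ξ y i) O)
    (hX : ∀ i, ContDiffOn ℝ ∞ (fun y => X y i) O)
    (hT : ∀ i j, ContDiffOn ℝ ∞ (fun y => T y i j) O) (hx : x ∈ O) (i j : ι) :
    lie2 ξ (lie2 X T) x i j - lie2 X (lie2 ξ T) x i j = lie2 (bracket ξ X) T x i j := by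
  rw [lie2, lie2, lie2]
  simp only [pd_lie2 hO hξ hT hx, pd_lie2 hO hX hT hx, pd_bracket hO hξ hX hx]
  simp only [lie2, bracket, Finset.mul_sum, Finset.sum_mul, ← Finset.sum_add_distrib,
    ← Finset.sum_sub_distrib]
  refine sum_sum_eq_of_swap fun m l => ?_
  rw [pd_comm hO (hξ m) hx l i, pd_comm hO (hξ l) hx m i, pd_comm hO (hξ m) hx l j,
    pd_comm hO (hξ l) hx m j, pd_comm hO (hX m) hx l i, pd_comm hO (hX l) hx m i,
    pd_comm hO (hX m) hx l j, pd_comm hO (hX l) hx m j, pd_comm hO (hT i j) hx l m]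
  ring

/-- Exterior differentiation of one-forms commutes with the Lie derivative. -/
theorem pd_lie1_sub (hO : IsOpen O) (hξ : ∀ i, ContDiffOn ℝ ∞ (fun y => ξ y i) O)
    (hW : ∀ i, ContDiffOn ℝ ∞ (fun y => W y i) O) (hx : x ∈ O) (i j : ι) :
    pd j (fun y => lie1 ξ W y i) x - pd i (fun y => lie1 ξ W y j) x
      = lie2 ξ (fun y i j => pd j (fun z => W z i) y - pd i (fun z => W z j) y) x i j := by
  have d {F : (ι → ℝ) → ℝ} (hF : ContDiffOn ℝ ∞ F O) : DifferentiableAt ℝ F x :=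
    differentiableAt_of_smooth hO hF hx
  rw [pd_lie1 hO hξ hW hx, pd_lie1 hO hξ hW hx, lie2, ← Finset.sum_sub_distrib]
  refine Finset.sum_congr rfl fun l _ => ?_
  rw [pd_sub (d (smooth_pd hO (hW i) j)) (d (smooth_pd hO (hW j) i)),
    pd_comm hO (hW i) hx l j, pd_comm hO (hW j) hx l i, pd_comm hO (hξ l) hx i j]
  ring

/-- The Leibniz rule for the contraction of a covariant 2-tensor with a vector field. -/
theorem lie1_contract (hO : IsOpen O) (hX : ∀ i, ContDiffOn ℝ ∞ (fun y => X y i) O)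
    (hT : ∀ i j, ContDiffOn ℝ ∞ (fun y => T y i j) O) (hx : x ∈ O) (i : ι) :
    lie1 ξ (fun y i => ∑ j, T y i j * X y j) x i
      = ∑ j, (lie2 ξ T x i j * X x j + T x i j * bracket ξ X x j) := by
  have d {F : (ι → ℝ) → ℝ} (hF : ContDiffOn ℝ ∞ F O) : DifferentiableAt ℝ F x :=
    differentiableAt_of_smooth hO hF hx
  have hp (m : ι) : pd m (fun y => ∑ j, T y i j * X y j) x
      = ∑ j, (pd m (fun y => T y i j) x * X x j + T x i j * pd m (fun y => X y j) x) := by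
    rw [pd_sum _ fun j _ => (d (hT i j)).fun_mul (d (hX j))]
    exact Finset.sum_congr rfl fun j _ => pd_mul (d (hT i j)) (d (hX j)) m
  simp only [lie1, hp, lie2, bracket, Finset.mul_sum, Finset.sum_mul, ← Finset.sum_add_distrib]
  exact sum_sum_eq_of_swap fun m l => by ring

/-- The Leibniz rule for the square of a one-form. -/
theorem lie2_mul_self (hO : IsOpen O) (hW : ∀ i, ContDiffOn ℝ ∞ (fun y => W y i) O)
    (hx : x ∈ O) (i j : ι) :
    lie2 ξ (fun y i j => W y i * W y j) x i j
      = lie1 ξ W x i * W x j + W x i * lie1 ξ W x j := by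
  have d {F : (ι → ℝ) → ℝ} (hF : ContDiffOn ℝ ∞ F O) : DifferentiableAt ℝ F x :=
    differentiableAt_of_smooth hO hF hx
  simp only [lie1, lie2, Finset.mul_sum, Finset.sum_mul, ← Finset.sum_add_distrib]
  refine Finset.sum_congr rfl fun l _ => ?_
  rw [pd_mul (d (hW i)) (d (hW j))]
  ring

theorem lie2_congr {T' : (ι → ℝ) → ι → ι → ℝ} (hO : IsOpen O) (hx : x ∈ O)
    (h : ∀ y ∈ O, ∀ i j, T y i j = T' y i j) (i j : ι) :
    lie2 ξ T x i j = lie2 ξ T' x i j := by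
  refine Finset.sum_congr rfl fun l _ => ?_
  rw [pd_congr hO hx (fun y hy => h y hy i j) l, h x hx, h x hx]

theorem lie1_congr {W' : (ι → ℝ) → ι → ℝ} (hO : IsOpen O) (hx : x ∈ O)
    (h : ∀ y ∈ O, ∀ i, W y i = W' y i) (i : ι) :
    lie1 ξ W x i = lie1 ξ W' x i := by
  refine Finset.sum_congr rfl fun l _ => ?_
  rw [pd_congr hO hx (fun y hy => h y hy i) l, h x hx]

theorem lie2_eq_zero (hO : IsOpen O) (hx : x ∈ O) (h : ∀ y ∈ O, ∀ i j, T y i j = 0) (i j : ι) :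
    lie2 ξ T x i j = 0 :=
  Finset.sum_eq_zero fun l _ => by
    rw [pd_eq_zero hO hx (fun y hy => h y hy i j) l, h x hx, h x hx]; ring

theorem lie1_eq_zero (hO : IsOpen O) (hx : x ∈ O) (h : ∀ y ∈ O, ∀ i, W y i = 0) (i : ι) :
    lie1 ξ W x i = 0 :=
  Finset.sum_eq_zero fun l _ => by
    rw [pd_eq_zero hO hx (fun y hy => h y hy i) l, h x hx]; ring

theorem lie2_sub {T' : (ι → ℝ) → ι → ι → ℝ} (hT : ∀ i j, DifferentiableAt ℝ (fun y => T y i j) x)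
    (hT' : ∀ i j, DifferentiableAt ℝ (fun y => T' y i j) x) (i j : ι) :
    lie2 ξ (fun y i j => T y i j - T' y i j) x i j = lie2 ξ T x i j - lie2 ξ T' x i j := by
  rw [lie2, lie2, lie2, ← Finset.sum_sub_distrib]
  refine Finset.sum_congr rfl fun l _ => ?_
  rw [pd_sub (hT i j) (hT' i j)]; ring

theorem lie2_const_mul (c : ℝ) (hT : ∀ i j, DifferentiableAt ℝ (fun y => T y i j) x) (i j : ι) :
    lie2 ξ (fun y i j => c * T y i j) x i j = c * lie2 ξ T x i j := by
  rw [lie2, lie2, Finset.mul_sum]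
  refine Finset.sum_congr rfl fun l _ => ?_
  rw [pd_const_mul c (hT i j)]; ring

end Calculus

section Metric

/-! ### The metric, its inverse, and covariant derivatives -/

theorem metric_symm {ι : Type} [Fintype ι] {U : Set (ι → ℝ)} {x : ι → ℝ}
    {g : (ι → ℝ) → Matrix ι ι ℝ} (hg : IsRiemannianOn g U) (hx : x ∈ U) (i j : ι) :
    g x i j = g x j i := by
  simpa using (hg.2 x hx).isHermitian.apply j i

variable {ι : Type} [Fintype ι] [DecidableEq ι] {U : Set (ι → ℝ)} {x : ι → ℝ}
  {g : (ι → ℝ) → Matrix ι ι ℝ} {w : (ι → ℝ) → ι → ℝ}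

theorem smooth_det (hg : ∀ i j, ContDiffOn ℝ ∞ (fun y => g y i j) U) :
    ContDiffOn ℝ ∞ (fun y => (g y).det) U := by
  simp only [Matrix.det_apply']
  exact ContDiffOn.sum fun σ _ => contDiffOn_const.mul (contDiffOn_prod fun i _ => hg _ _)

theorem smooth_inv (hg : IsRiemannianOn g U) (i j : ι) :
    ContDiffOn ℝ ∞ (fun y => (g y)⁻¹ i j) U := by
  have hadj : ContDiffOn ℝ ∞ (fun y => (g y).adjugate i j) U := by
    simp only [Matrix.adjugate_apply]
    refine smooth_det fun a b => ?_
    by_cases h : a = j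
    · subst h
      simpa using contDiffOn_const
    · simpa [Matrix.updateRow_ne h] using hg.1 a b
  simp only [Matrix.inv_def, Ring.inverse_eq_inv', Matrix.smul_apply, smul_eq_mul]
  exact ((smooth_det hg.1).inv fun y hy => (hg.2 y hy).det_pos.ne').mul hadj

/-- The vector field `w^i = g^{ij} w_j`. -/
noncomputable def sharp (g : (ι → ℝ) → Matrix ι ι ℝ) (w : (ι → ℝ) → ι → ℝ) (x : ι → ℝ)
    (i : ι) : ℝ :=
  ∑ j, (g x)⁻¹ i j * w x j

theorem smooth_sharp (hg : IsRiemannianOn g U) (hw : ∀ i, ContDiffOn ℝ ∞ (fun y => w y i) U)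
    (i : ι) : ContDiffOn ℝ ∞ (fun y => sharp g w y i) U :=
  ContDiffOn.sum fun j _ => (smooth_inv hg i j).mul (hw j)

theorem inv_symm (hg : IsRiemannianOn g U) (hx : x ∈ U) (i j : ι) :
    (g x)⁻¹ i j = (g x)⁻¹ j i := by
  simpa using (hg.2 x hx).isHermitian.inv.apply j i

theorem metric_mul_sharp (hg : IsRiemannianOn g U) (hx : x ∈ U) (i : ι) :
    ∑ j, g x i j * sharp g w x j = w x i := by
  have h : g x * (g x)⁻¹ = 1 := Matrix.mul_nonsing_inv _ (hg.2 x hx).det_pos.ne'.isUnit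
  have := congrFun (congrArg (fun M => M.mulVec (w x)) h) i
  simp only [← Matrix.mulVec_mulVec, Matrix.one_mulVec] at this
  exact this

theorem eq_sharp (hg : IsRiemannianOn g U) (hx : x ∈ U) {Y : ι → ℝ}
    (h : ∀ i, ∑ j, g x i j * Y j = w x i) (i : ι) : Y i = sharp g w x i := by
  have h' : (g x)⁻¹ * g x = 1 := Matrix.nonsing_inv_mul _ (hg.2 x hx).det_pos.ne'.isUnit
  have := congrFun (congrArg (fun M => M.mulVec Y) h') i
  simp only [← Matrix.mulVec_mulVec, Matrix.one_mulVec] at this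
  rw [← this]
  exact Finset.sum_congr rfl fun j _ => by rw [← h j]; rfl

theorem christoffel_symm (hU : IsOpen U) (hg : IsRiemannianOn g U) (hx : x ∈ U) (k i j : ι) :
    christoffel g x k i j = christoffel g x k j i := by
  simp only [christoffel]
  congr 1
  refine Finset.sum_congr rfl fun l _ => ?_
  rw [pd_congr hU hx (fun y hy => metric_symm hg hy i j) l]
  ring

theorem covDeriv_sub_swap (hU : IsOpen U) (hg : IsRiemannianOn g U) (hx : x ∈ U) (i j : ι) :
    covDeriv g w x i j - covDeriv g w x j i
      = pd j (fun y => w y i) x - pd i (fun y => w y j) x := by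
  simp only [covDeriv, christoffel_symm hU hg hx _ j i]
  ring

theorem pd_metric_mul_sharp (hU : IsOpen U) (hg : IsRiemannianOn g U)
    (hw : ∀ i, ContDiffOn ℝ ∞ (fun y => w y i) U) (hx : x ∈ U) (i j : ι) :
    pd j (fun y => w y i) x = ∑ l, (pd j (fun y => g y i l) x * sharp g w x l
      + g x i l * pd j (fun y => sharp g w y l) x) := by
  have d {F : (ι → ℝ) → ℝ} (hF : ContDiffOn ℝ ∞ F U) : DifferentiableAt ℝ F x :=
    differentiableAt_of_smooth hU hF hx
  rw [← pd_congr hU hx (fun y hy => metric_mul_sharp hg hy i) j,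
    pd_sum _ fun l _ => (d (hg.1 i l)).fun_mul (d (smooth_sharp hg hw l))]
  exact Finset.sum_congr rfl fun l _ => pd_mul (d (hg.1 i l)) (d (smooth_sharp hg hw l)) j

/-- The symmetrized covariant derivative of a one-form is the Lie derivative of the metric along
the dual vector field. -/
theorem covDeriv_add_swap (hU : IsOpen U) (hg : IsRiemannianOn g U)
    (hw : ∀ i, ContDiffOn ℝ ∞ (fun y => w y i) U) (hx : x ∈ U) (i j : ι) :
    covDeriv g w x i j + covDeriv g w x j i = lie2 (sharp g w) (fun y => g y) x i j := by
  have hΓ : ∑ k, christoffel g x k i j * w x k = (1 / 2) * ∑ l, sharp g w x l *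
      (pd i (fun y => g y l j) x + pd j (fun y => g y l i) x - pd l (fun y => g y i j) x) := by
    simp only [christoffel, sharp, Finset.mul_sum, Finset.sum_mul]
    rw [Finset.sum_comm]
    refine Finset.sum_congr rfl fun l _ => Finset.sum_congr rfl fun k _ => ?_
    rw [inv_symm hg hx k l]
    ring
  have hsym : ∑ k, christoffel g x k j i * w x k = ∑ k, christoffel g x k i j * w x k := by
    simp only [christoffel_symm hU hg hx _ j i]
  rw [covDeriv, covDeriv, hsym, hΓ, pd_metric_mul_sharp hU hg hw hx i j,
    pd_metric_mul_sharp hU hg hw hx j i]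
  unfold lie2
  have e : ∀ a b c : ℝ, a - 1 / 2 * c + (b - 1 / 2 * c) = a + b - c := by intros; ring
  rw [e, ← Finset.sum_add_distrib, ← Finset.sum_sub_distrib]
  refine Finset.sum_congr rfl fun l _ => ?_
  rw [pd_congr hU hx (fun y hy => metric_symm hg hy i l) j,
    pd_congr hU hx (fun y hy => metric_symm hg hy j l) i, metric_symm hg hx j l]
  ring

end Metric

/-! ### Invariant Killing fields of a Kundt triple -/

namespace KundtTriple

variable {ι : Type} [Fintype ι] [DecidableEq ι] {U O : Set (ι → ℝ)} {T : KundtTriple U}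
  {ξ : (ι → ℝ) → ι → ℝ} {x : ι → ℝ}

theorem s_eq (hU : IsOpen U) (hx : x ∈ U) (i j : ι) :
    T.s x i j = (1 / 2) * (lie2 (sharp T.h T.W) (fun y => T.h y) x i j - T.W x i * T.W x j) := by
  rw [s, covDeriv_add_swap hU T.riemannian T.smooth_W hx]
  ring

theorem a_eq (hU : IsOpen U) (hx : x ∈ U) (i j : ι) :
    T.a x i j = (1 / 2) * (pd j (fun z => T.W z i) x - pd i (fun z => T.W z j) x) := by
  rw [a, covDeriv_sub_swap hU T.riemannian hx]

/-- Under a Killing field, `L_ξ W` is the metric dual of the bracket `[ξ, W^♯]`. -/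
theorem metric_mul_bracket (hU : IsOpen U) (hO : IsOpen O) (hOU : O ⊆ U)
    (hξ : T.IsInvariantKilling O ξ) (hx : x ∈ O) (i : ι) :
    ∑ j, T.h x i j * bracket ξ (sharp T.h T.W) x j = lie1 ξ T.W x i := by
  have hX := smooth_sharp T.riemannian T.smooth_W
  have key := lie1_contract (ξ := ξ) (T := fun y i j => T.h y i j) hU hX T.riemannian.1 (hOU hx) i
  rw [← lie1_congr (W := fun y i => ∑ j, T.h y i j * sharp T.h T.W y j) hO hx
    (fun y hy i => metric_mul_sharp T.riemannian (hOU hy) i) i, key]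
  refine Finset.sum_congr rfl fun j _ => ?_
  rw [show lie2 ξ (fun y i j => T.h y i j) x i j = 0 from (hξ.2 x hx).1 i j]
  ring

/-- Invariance of `a` means that `w = L_ξ W` is closed. -/
theorem lie1_closed (hU : IsOpen U) (hO : IsOpen O) (hOU : O ⊆ U)
    (hξ : T.IsInvariantKilling O ξ) (hx : x ∈ O) (i j : ι) :
    pd j (fun y => lie1 ξ T.W y i) x = pd i (fun y => lie1 ξ T.W y j) x := by
  have hW i := (T.smooth_W i).mono hOU
  have d i j := differentiableAt_of_smooth hO ((smooth_pd hO (hW i) j).sub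
    (smooth_pd hO (hW j) i)) hx
  have h := (hξ.2 x hx).2.1 i j
  rw [lie2_congr hO hx (fun y hy i j => a_eq hU (hOU hy) i j),
    lie2_const_mul _ (fun i j => d i j), ← pd_lie1_sub hO hξ.1 hW hx] at h
  linarith

/-- Invariance of `s` means that the vector field `Y = [ξ, W^♯]` dual to `w = L_ξ W` satisfies
`L_Y h = w ⊗ W + W ⊗ w`. -/
theorem lie2_bracket (hU : IsOpen U) (hO : IsOpen O) (hOU : O ⊆ U)
    (hξ : T.IsInvariantKilling O ξ) (hx : x ∈ O) (i j : ι) :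
    lie2 (bracket ξ (sharp T.h T.W)) (fun y => T.h y) x i j
      = lie1 ξ T.W x i * T.W x j + T.W x i * lie1 ξ T.W x j := by
  have hW i := (T.smooth_W i).mono hOU
  have hh i j := (T.riemannian.1 i j).mono hOU
  have hX i := (smooth_sharp T.riemannian T.smooth_W i).mono hOU
  have hL := smooth_lie2 (T := fun y => T.h y) hO hX hh
  have hWW i j := (hW i).mul (hW j)
  have h := (hξ.2 x hx).2.2.1 i j
  rw [lie2_congr hO hx (fun y hy i j => s_eq hU (hOU hy) i j),
    lie2_const_mul _ (fun i j => differentiableAt_of_smooth hO ((hL i j).sub (hWW i j)) hx),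
    lie2_sub (fun i j => differentiableAt_of_smooth hO (hL i j) hx)
      (fun i j => differentiableAt_of_smooth hO (hWW i j) hx),
    lie2_mul_self hO hW hx] at h
  have hzero := lie2_eq_zero (ξ := sharp T.h T.W) hO hx
    (fun y hy i j => (hξ.2 y hy).1 i j) i j
  have hcomm := lie2_lie2_sub (T := fun y => T.h y) hO hξ.1 hX hh hx i j
  linarith

end KundtTriple

/-! ### Warped products -/

section Warped

variable {m k : ℕ} {B : Set (Fin m → ℝ)} {V : Set (Fin k → ℝ)} {x : Fin m ⊕ Fin k → ℝ}

theorem isOpen_productDomain (hB : IsOpen B) (hV : IsOpen V) : IsOpen (productDomain B V) :=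
  (hB.preimage (by unfold basePt; fun_prop)).inter (hV.preimage (by unfold fiberPt; fun_prop))

theorem pd_comp_basePt {F : (Fin m → ℝ) → ℝ} (hF : DifferentiableAt ℝ F (basePt x))
    (i : Fin m ⊕ Fin k) :
    pd i (fun y => F (basePt y)) x = Sum.elim (fun A => pd A F (basePt x)) (fun _ => 0) i := by
  let L : (Fin m ⊕ Fin k → ℝ) →L[ℝ] (Fin m → ℝ) :=
    ContinuousLinearMap.pi fun A => ContinuousLinearMap.proj (Sum.inl A)
  have hL : HasFDerivAt (fun y => F (basePt y)) ((fderiv ℝ F (basePt x)).comp L) x :=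
    HasFDerivAt.comp (f := L) x hF.hasFDerivAt L.hasFDerivAt
  rw [pd, hL.fderiv, ContinuousLinearMap.comp_apply]
  rcases i with A | c
  · rw [show L (Pi.single (Sum.inl A) 1) = Pi.single A 1 by
      ext C; simp [L, Pi.single_apply]]
    rfl
  · rw [show L (Pi.single (Sum.inr c) 1) = 0 by ext C; simp [L]]
    simp

theorem pd_comp_fiberPt {F : (Fin k → ℝ) → ℝ} (hF : DifferentiableAt ℝ F (fiberPt x))
    (A : Fin m) : pd (Sum.inl A) (fun y => F (fiberPt y)) x = 0 := by
  let L : (Fin m ⊕ Fin k → ℝ) →L[ℝ] (Fin k → ℝ) :=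
    ContinuousLinearMap.pi fun c => ContinuousLinearMap.proj (Sum.inr c)
  have hL : HasFDerivAt (fun y => F (fiberPt y)) ((fderiv ℝ F (fiberPt x)).comp L) x :=
    HasFDerivAt.comp (f := L) x hF.hasFDerivAt L.hasFDerivAt
  rw [pd, hL.fderiv, ContinuousLinearMap.comp_apply,
    show L (Pi.single (Sum.inl A) 1) = 0 by ext C; simp [L]]
  simp

variable {hB : (Fin m → ℝ) → Matrix (Fin m) (Fin m) ℝ}
  {hF : (Fin k → ℝ) → Matrix (Fin k) (Fin k) ℝ} {f : (Fin m → ℝ) → ℝ}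
  {g : (Fin m ⊕ Fin k → ℝ) → Matrix (Fin m ⊕ Fin k) (Fin m ⊕ Fin k) ℝ}
  {O : Set (Fin m ⊕ Fin k → ℝ)} {Y : (Fin m ⊕ Fin k → ℝ) → Fin m ⊕ Fin k → ℝ}

/-- A vector that is orthogonal to the fibres has no fibre components. -/
theorem fiber_eq_zero_of_metric_mul (hwarp : ∀ y ∈ productDomain B V, g y = warpedMetric hB hF f y)
    (hFriem : IsRiemannianOn hF V) (hx : x ∈ productDomain B V) {v : Fin m ⊕ Fin k → ℝ}
    (h : ∀ b, ∑ j, g x (Sum.inr b) j * v j = 0) (c : Fin k) : v (Sum.inr c) = 0 := by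
  have h0 : (hF (fiberPt x)).mulVec (fun c => v (Sum.inr c)) = 0 := by
    ext b
    have := h b
    simp only [hwarp x hx, warpedMetric, Fintype.sum_sum_type, Matrix.fromBlocks_apply₂₁,
      Matrix.zero_apply, zero_mul, Finset.sum_const_zero, zero_add, Matrix.fromBlocks_apply₂₂,
      Matrix.smul_apply, smul_eq_mul, mul_assoc, ← Finset.mul_sum] at this
    exact (mul_eq_zero.1 this).resolve_left (Real.exp_ne_zero _)
  exact congrFun (Matrix.eq_zero_of_mulVec_eq_zero (hFriem.2 _ hx.2).det_pos.ne' h0) c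

/-- Along a vector field tangent to the base, the fibre metric only changes by the derivative of
the warping function. -/
theorem lie2_warped_fiber (hwarp : ∀ y ∈ productDomain B V, g y = warpedMetric hB hF f y)
    (hBo : IsOpen B) (hVo : IsOpen V) (hf : ContDiffOn ℝ ∞ f B) (hFriem : IsRiemannianOn hF V)
    (hO : IsOpen O) (hOU : O ⊆ productDomain B V) (hY : ∀ y ∈ O, ∀ c, Y y (Sum.inr c) = 0)
    (hx : x ∈ O) (a b : Fin k) :
    lie2 Y (fun y => g y) x (Sum.inr a) (Sum.inr b)
      = 2 * (∑ C, Y x (Sum.inl C) * pd C f (basePt x)) * g x (Sum.inr a) (Sum.inr b) := by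
  have hxU := hOU hx
  have dfb : DifferentiableAt ℝ f (basePt x) := differentiableAt_of_smooth hBo hf hxU.1
  have dexp : DifferentiableAt ℝ (fun z => Real.exp (2 * f z)) (basePt x) := by fun_prop
  have dF : DifferentiableAt ℝ (fun z => hF z a b) (fiberPt x) :=
    differentiableAt_of_smooth hVo (hFriem.1 a b) hxU.2
  have hpdexp (C : Fin m) : pd C (fun z => Real.exp (2 * f z)) (basePt x)
      = Real.exp (2 * f (basePt x)) * (2 * pd C f (basePt x)) := by
    rw [pd, fderiv_exp (by fun_prop), fderiv_const_mul dfb]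
    simp [pd]
  have hpd (C : Fin m) : pd (Sum.inl C) (fun y => g y (Sum.inr a) (Sum.inr b)) x
      = 2 * pd C f (basePt x) * g x (Sum.inr a) (Sum.inr b) := by
    rw [pd_congr (G := fun y => Real.exp (2 * f (basePt y)) * hF (fiberPt y) a b)
      (isOpen_productDomain hBo hVo) hxU (fun y hy => by simp [hwarp y hy, warpedMetric]),
      pd_mul (F := fun y => Real.exp (2 * f (basePt y))) (G := fun y => hF (fiberPt y) a b)
        (by unfold basePt at *; fun_prop) (by unfold fiberPt at *; fun_prop),
      pd_comp_basePt dexp, pd_comp_fiberPt dF, hwarp x hxU]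
    simp [warpedMetric, hpdexp]
    ring
  have hz (i : Fin m ⊕ Fin k) (c : Fin k) : pd i (fun y => Y y (Sum.inr c)) x = 0 :=
    pd_eq_zero hO hx (fun y hy => hY y hy c) i
  have hg (C : Fin m) (c : Fin k) : g x (Sum.inl C) (Sum.inr c) = 0
      ∧ g x (Sum.inr c) (Sum.inl C) = 0 := by simp [hwarp x hxU, warpedMetric]
  simp only [lie2, Fintype.sum_sum_type, hz, hY x hx, hpd, (hg _ _).1, (hg _ _).2]
  simp only [zero_mul, mul_zero, add_zero, Finset.sum_const_zero, Finset.mul_sum, Finset.sum_mul]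
  exact Finset.sum_congr rfl fun C _ => by ring

/-- For a vector field tangent to the base, the mixed components of `L_Y g` are the fibre
derivatives of the one-form dual to `Y`. -/
theorem lie2_warped_mixed (hwarp : ∀ y ∈ productDomain B V, g y = warpedMetric hB hF f y)
    (hBo : IsOpen B) (hVo : IsOpen V) (hBriem : IsRiemannianOn hB B)
    (hO : IsOpen O) (hOU : O ⊆ productDomain B V) (hY : ∀ y ∈ O, ∀ c, Y y (Sum.inr c) = 0)
    (hYs : ∀ i, ContDiffOn ℝ ∞ (fun y => Y y i) O) (hx : x ∈ O) (A : Fin m) (b : Fin k) :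
    lie2 Y (fun y => g y) x (Sum.inl A) (Sum.inr b)
      = pd (Sum.inr b) (fun y => ∑ j, g y (Sum.inl A) j * Y y j) x := by
  have hxU := hOU hx
  have d i := differentiableAt_of_smooth hO (hYs i) hx
  have dB (C : Fin m) : DifferentiableAt ℝ (fun z => hB z A C) (basePt x) :=
    differentiableAt_of_smooth hBo (hBriem.1 A C) hxU.1
  have dB' (C : Fin m) : DifferentiableAt ℝ
      (fun y : Fin m ⊕ Fin k → ℝ => hB (basePt y) A C) x := by
    have := dB C
    unfold basePt at *; fun_prop
  have hg : ∀ y ∈ productDomain B V, ∀ (C : Fin m) (c : Fin k), g y (Sum.inl C) (Sum.inr c) = 0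
      ∧ g y (Sum.inr c) (Sum.inl C) = 0 := fun y hy C c => by simp [hwarp y hy, warpedMetric]
  have hsum : pd (Sum.inr b) (fun y => ∑ j, g y (Sum.inl A) j * Y y j) x
      = ∑ C, g x (Sum.inl A) (Sum.inl C) * pd (Sum.inr b) (fun y => Y y (Sum.inl C)) x := by
    rw [pd_congr (G := fun y => ∑ C, hB (basePt y) A C * Y y (Sum.inl C)) hO hx (fun y hy => by
      simp [hwarp y (hOU hy), warpedMetric]),
      pd_sum _ fun C _ => (dB' C).fun_mul (d _)]
    refine Finset.sum_congr rfl fun C _ => ?_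
    rw [pd_mul (dB' C) (d _), pd_comp_basePt (dB C), hwarp x hxU]
    simp [warpedMetric]
  have hz (i : Fin m ⊕ Fin k) (c : Fin k) : pd i (fun y => Y y (Sum.inr c)) x = 0 :=
    pd_eq_zero hO hx (fun y hy => hY y hy c) i
  have hpd (i : Fin m ⊕ Fin k) : pd i (fun y => g y (Sum.inl A) (Sum.inr b)) x = 0 :=
    pd_eq_zero (isOpen_productDomain hBo hVo) hxU (fun y hy => (hg y hy A b).1) i
  rw [hsum]
  simp only [lie2, Fintype.sum_sum_type, hz, hY x hx, hpd, (hg x hxU _ _).1]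
  simp

end Warped

/-! ### Triples adapted to a warped product -/

namespace KundtTriple

variable {m k : ℕ} {B : Set (Fin m → ℝ)} {V : Set (Fin k → ℝ)}
  {T : KundtTriple (productDomain B V)} {O : Set (Fin m ⊕ Fin k → ℝ)}
  {hB : (Fin m → ℝ) → Matrix (Fin m) (Fin m) ℝ} {hF : (Fin k → ℝ) → Matrix (Fin k) (Fin k) ℝ}
  {f : (Fin m → ℝ) → ℝ} {x : Fin m ⊕ Fin k → ℝ} {ξ : (Fin m ⊕ Fin k → ℝ) → Fin m ⊕ Fin k → ℝ}

theorem lie1_fiber_eq_zero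
    (hadapt : ∀ p ∈ productDomain B V, ∀ w ∈ T.I1 p, ∀ c, w (Sum.inr c) = 0)
    (hO : IsOpen O) (hOU : O ⊆ productDomain B V) (hξ : T.IsInvariantKilling O ξ)
    (hx : x ∈ O) (c : Fin k) : lie1 ξ T.W x (Sum.inr c) = 0 :=
  hadapt x (hOU hx) _ (Submodule.subset_span ⟨O, hO, hx, hOU, _, ⟨ξ, hξ, rfl⟩, rfl⟩) c

/-- The vector field dual to `L_ξ W` is tangent to the base. -/
theorem bracket_fiber_eq_zero (hBo : IsOpen B) (hVo : IsOpen V)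
    (hwarp : ∀ y ∈ productDomain B V, T.h y = warpedMetric hB hF f y)
    (hFriem : IsRiemannianOn hF V)
    (hadapt : ∀ p ∈ productDomain B V, ∀ w ∈ T.I1 p, ∀ c, w (Sum.inr c) = 0)
    (hO : IsOpen O) (hOU : O ⊆ productDomain B V) (hξ : T.IsInvariantKilling O ξ)
    (hx : x ∈ O) (c : Fin k) : bracket ξ (sharp T.h T.W) x (Sum.inr c) = 0 :=
  fiber_eq_zero_of_metric_mul hwarp hFriem (hOU hx) (fun b => by
    rw [metric_mul_bracket (isOpen_productDomain hBo hVo) hO hOU hξ hx,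
      lie1_fiber_eq_zero hadapt hO hOU hξ hx]) c

/-- The fibre components of `L_Y h = w ⊗ W + W ⊗ w` say that the dual vector of `w` annihilates
the warping function. -/
theorem sharp_warping_eq_zero [NeZero k] (hBo : IsOpen B) (hVo : IsOpen V)
    (hwarp : ∀ y ∈ productDomain B V, T.h y = warpedMetric hB hF f y)
    (hFriem : IsRiemannianOn hF V) (hf : ContDiffOn ℝ ∞ f B)
    (hadapt : ∀ p ∈ productDomain B V, ∀ w ∈ T.I1 p, ∀ c, w (Sum.inr c) = 0)
    (hx : x ∈ productDomain B V) {w : Fin m ⊕ Fin k → ℝ} (hw : w ∈ T.valuesAt 0 x) :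
    ∑ C, ((T.h x)⁻¹.mulVec w) (Sum.inl C) * pd C f (basePt x) = 0 := by
  obtain ⟨O, hO, hxO, hOU, _, ⟨ξ, hξ, rfl⟩, rfl⟩ := hw
  have hU := isOpen_productDomain hBo hVo
  have key := lie2_bracket hU hO hOU hξ hxO (Sum.inr 0) (Sum.inr 0)
  rw [lie2_warped_fiber hwarp hBo hVo hf hFriem hO hOU (fun y hy c =>
    bracket_fiber_eq_zero hBo hVo hwarp hFriem hadapt hO hOU hξ hy c) hxO,
    lie1_fiber_eq_zero hadapt hO hOU hξ hxO] at key
  have hpos := (T.riemannian.2 x hx).diag_pos (i := Sum.inr 0)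
  have h0 : ∑ C, bracket ξ (sharp T.h T.W) x (Sum.inl C) * pd C f (basePt x) = 0 := by
    have : 2 * (∑ C, bracket ξ (sharp T.h T.W) x (Sum.inl C) * pd C f (basePt x)) = 0 :=
      (mul_eq_zero.1 (key.trans (by ring))).resolve_right hpos.ne'
    linarith
  rw [← h0]
  refine Finset.sum_congr rfl fun C _ => ?_
  rw [eq_sharp T.riemannian hx
    (fun i => metric_mul_bracket hU hO hOU hξ hxO i)]
  rfl

/-- The mixed components of `L_Y h = w ⊗ W + W ⊗ w` say that `W` is tangent to the base where
`w` does not vanish: the left-hand side is zero because `w` is closed. -/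
theorem mul_W_fiber_eq_zero (hBo : IsOpen B) (hVo : IsOpen V)
    (hwarp : ∀ y ∈ productDomain B V, T.h y = warpedMetric hB hF f y)
    (hBriem : IsRiemannianOn hB B) (hFriem : IsRiemannianOn hF V)
    (hadapt : ∀ p ∈ productDomain B V, ∀ w ∈ T.I1 p, ∀ c, w (Sum.inr c) = 0)
    {w : Fin m ⊕ Fin k → ℝ} (hw : w ∈ T.valuesAt 0 x) (A : Fin m) (b : Fin k) :
    w (Sum.inl A) * T.W x (Sum.inr b) = 0 := by
  obtain ⟨O, hO, hxO, hOU, _, ⟨ξ, hξ, rfl⟩, rfl⟩ := hw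
  have hU := isOpen_productDomain hBo hVo
  have hX i := (smooth_sharp T.riemannian T.smooth_W i).mono hOU
  have hYs (i) : ContDiffOn ℝ ∞ (fun y => bracket ξ (sharp T.h T.W) y i) O :=
    ContDiffOn.sum fun l _ => ((hξ.1 l).mul (smooth_pd hO (hX i) l)).sub
      ((hX l).mul (smooth_pd hO (hξ.1 i) l))
  have key := lie2_bracket hU hO hOU hξ hxO (Sum.inl A) (Sum.inr b)
  rw [lie2_warped_mixed hwarp hBo hVo hBriem hO hOU (fun y hy c =>
      bracket_fiber_eq_zero hBo hVo hwarp hFriem hadapt hO hOU hξ hy c) hYs hxO,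
    pd_congr hO hxO (fun y hy => metric_mul_bracket hU hO hOU hξ hy (Sum.inl A)),
    lie1_closed hU hO hOU hξ hxO,
    pd_eq_zero hO hxO (fun y hy => lie1_fiber_eq_zero hadapt hO hOU hξ hy b),
    lie1_fiber_eq_zero hadapt hO hOU hξ hxO] at key
  linarith

/-- A dimension count: `I^1|_p` consists of all the covectors that vanish along the fibres. -/
theorem mem_I1_of_fiber_eq_zero (hI1 : Module.finrank ℝ (T.I1 x) = m)
    (hadapt : ∀ w ∈ T.I1 x, ∀ c, w (Sum.inr c) = 0) {w : Fin m ⊕ Fin k → ℝ}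
    (hw : ∀ c, w (Sum.inr c) = 0) : w ∈ T.I1 x := by
  -- Restriction to the base components is injective on `I^1|_p`, hence onto.
  let L : T.I1 x →ₗ[ℝ] (Fin m → ℝ) := (LinearMap.funLeft ℝ ℝ Sum.inl).comp (T.I1 x).subtype
  have hL : Function.Injective L := by
    rw [← LinearMap.ker_eq_bot, LinearMap.ker_eq_bot']
    intro v hv
    ext i
    rcases i with A | c
    · exact congrFun hv A
    · exact hadapt v v.2 c
  obtain ⟨v, hv⟩ := (LinearMap.injective_iff_surjective_of_finrank_eq_finrank
    (by simpa using hI1)).1 hL (fun A => w (Sum.inl A))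
  have : (v : Fin m ⊕ Fin k → ℝ) = w := by
    ext i
    rcases i with A | c
    · exact congrFun hv A
    · rw [hw c]; exact hadapt v v.2 c
  exact this ▸ v.2

/-- The iterated Lie derivatives vanish when the first ones do. -/
theorem calI_eq_bot (h : ∀ p ∈ productDomain B V, T.I1 p = ⊥) (p : Fin m ⊕ Fin k → ℝ) :
    T.calI p = ⊥ := by
  have hr (O : Set (Fin m ⊕ Fin k → ℝ)) (hO : IsOpen O) (hOU : O ⊆ productDomain B V) (r : ℕ) :
      ∀ v ∈ T.iterLie O r, ∀ y ∈ O, ∀ i, v y i = 0 := by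
    induction r with
    | zero =>
      rintro _ ⟨ξ, hξ, rfl⟩ y hy i
      have : lie1 ξ T.W y ∈ T.I1 y :=
        Submodule.subset_span ⟨O, hO, hy, hOU, _, ⟨ξ, hξ, rfl⟩, rfl⟩
      rw [h y (hOU hy), Submodule.mem_bot] at this
      exact congrFun this i
    | succ r ih =>
      rintro _ ⟨ξ, _, w, hw, rfl⟩ y hy i
      exact lie1_eq_zero hO hy (ih w hw) i
  rw [calI, Submodule.span_eq_bot]
  intro c hc
  obtain ⟨r, O, hO, hp, hOU, v, hv, rfl⟩ := Set.mem_iUnion.1 hc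
  exact funext (hr O hO hOU r v hv p hp)

/-- The warping function of an adapted triple is locally constant. -/
theorem pd_warping_eq_zero [NeZero k] (hBo : IsOpen B) (hVo : IsOpen V)
    (hwarp : ∀ y ∈ productDomain B V, T.h y = warpedMetric hB hF f y)
    (hFriem : IsRiemannianOn hF V) (hf : ContDiffOn ℝ ∞ f B)
    (hI1 : ∀ p ∈ productDomain B V, Module.finrank ℝ (T.I1 p) = m)
    (hadapt : ∀ p ∈ productDomain B V, ∀ w ∈ T.I1 p, ∀ c, w (Sum.inr c) = 0)
    (hx : x ∈ productDomain B V) (C : Fin m) : pd C f (basePt x) = 0 := by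
  have hall : ∀ w ∈ T.I1 x, ∑ C, ((T.h x)⁻¹.mulVec w) (Sum.inl C) * pd C f (basePt x) = 0 := by
    intro w hw
    induction hw using Submodule.span_induction with
    | mem w hw => exact sharp_warping_eq_zero hBo hVo hwarp hFriem hf hadapt hx hw
    | zero => simp
    | add v w _ _ hv hw =>
      simp only [Matrix.mulVec_add, Pi.add_apply, add_mul, Finset.sum_add_distrib, hv, hw, add_zero]
    | smul c w _ hw =>
      simp only [Matrix.mulVec_smul, Pi.smul_apply, smul_eq_mul, mul_assoc, ← Finset.mul_sum, hw,
        mul_zero]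
  have hinv : (T.h x)⁻¹ * T.h x = 1 :=
    Matrix.nonsing_inv_mul _ (T.riemannian.2 x hx).det_pos.ne'.isUnit
  -- The covector dual to the coordinate vector `∂_C` lies in `I^1|_x`.
  have := hall ((T.h x).mulVec (Pi.single (Sum.inl C) 1))
    (mem_I1_of_fiber_eq_zero (hI1 x hx) (hadapt x hx) fun c => by
      simp [hwarp x hx, warpedMetric])
  rw [Matrix.mulVec_mulVec, hinv, Matrix.one_mulVec] at this
  simpa [Pi.single_apply] using this

theorem W_fiber_eq_zero [NeZero m] (hBo : IsOpen B) (hVo : IsOpen V)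
    (hwarp : ∀ y ∈ productDomain B V, T.h y = warpedMetric hB hF f y)
    (hBriem : IsRiemannianOn hB B) (hFriem : IsRiemannianOn hF V)
    (hI1 : ∀ p ∈ productDomain B V, Module.finrank ℝ (T.I1 p) = m)
    (hadapt : ∀ p ∈ productDomain B V, ∀ w ∈ T.I1 p, ∀ c, w (Sum.inr c) = 0)
    (hx : x ∈ productDomain B V) (b : Fin k) : T.W x (Sum.inr b) = 0 := by
  have hall : ∀ w ∈ T.I1 x, w (Sum.inl 0) * T.W x (Sum.inr b) = 0 := by
    intro w hw
    induction hw using Submodule.span_induction with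
    | mem w hw => exact mul_W_fiber_eq_zero hBo hVo hwarp hBriem hFriem hadapt hw 0 b
    | zero => simp
    | add v w _ _ hv hw => simp [add_mul, hv, hw]
    | smul c w _ hw => simp only [Pi.smul_apply, smul_eq_mul, mul_assoc, hw, mul_zero]
  simpa using hall (Pi.single (Sum.inl 0) 1)
    (mem_I1_of_fiber_eq_zero (hI1 x hx) (hadapt x hx) fun c => by simp)

theorem s_fiber_eq_zero [NeZero m] [NeZero k] (hBo : IsOpen B) (hVo : IsOpen V)
    (hwarp : ∀ y ∈ productDomain B V, T.h y = warpedMetric hB hF f y)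
    (hBriem : IsRiemannianOn hB B) (hFriem : IsRiemannianOn hF V) (hf : ContDiffOn ℝ ∞ f B)
    (hI1 : ∀ p ∈ productDomain B V, Module.finrank ℝ (T.I1 p) = m)
    (hadapt : ∀ p ∈ productDomain B V, ∀ w ∈ T.I1 p, ∀ c, w (Sum.inr c) = 0)
    (hx : x ∈ productDomain B V) (a b : Fin k) : T.s x (Sum.inr a) (Sum.inr b) = 0 := by
  have hU := isOpen_productDomain hBo hVo
  have hW {y} (hy : y ∈ productDomain B V) (c : Fin k) :=
    W_fiber_eq_zero hBo hVo hwarp hBriem hFriem hI1 hadapt hy c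
  rw [s_eq hU hx, lie2_warped_fiber hwarp hBo hVo hf hFriem hU subset_rfl
    (fun y hy c => fiber_eq_zero_of_metric_mul hwarp hFriem hy
      (fun b => (metric_mul_sharp T.riemannian hy _).trans (hW hy b)) c) hx, hW hx,
    Finset.sum_eq_zero fun C _ => by
      rw [pd_warping_eq_zero hBo hVo hwarp hFriem hf hI1 hadapt hx, mul_zero]]
  ring

end KundtTriple

end KundtInfinity

theorem mainTheorem11 {m k : ℕ}
    (B : Set (Fin m → ℝ)) (V : Set (Fin k → ℝ))
    (hBopen : IsOpen B) (hVopen : IsOpen V)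
    (hBconn : IsPreconnected B) (hVconn : IsPreconnected V)
    -- a locally homogeneous Kundt triple on the coordinate domain
    (T : KundtInfinity.KundtTriple (KundtInfinity.productDomain B V))
    (hT : T.LocallyHomogeneous)
    (hI1 : ∀ p ∈ KundtInfinity.productDomain B V, Module.finrank ℝ (T.I1 p) = m)
    (hI : ∀ p ∈ KundtInfinity.productDomain B V,
      0 < Module.finrank ℝ (T.calI p) ∧ Module.finrank ℝ (T.calI p) < m + k)
    -- the transverse space is a locally homogeneous warped product
    (hB : (Fin m → ℝ) → Matrix (Fin m) (Fin m) ℝ)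
    (hF : (Fin k → ℝ) → Matrix (Fin k) (Fin k) ℝ)
    (f : (Fin m → ℝ) → ℝ)
    (hBriem : KundtInfinity.IsRiemannianOn hB B)
    (hFriem : KundtInfinity.IsRiemannianOn hF V)
    (hf : ContDiffOn ℝ ∞ f B)
    (hwarp : ∀ x ∈ KundtInfinity.productDomain B V,
      T.h x = KundtInfinity.warpedMetric hB hF f x)
    (hlh : KundtInfinity.LocallyHomogeneousOn T.h (KundtInfinity.productDomain B V))
    (hBmax : KundtInfinity.MaximallySymmetricOn hB B)
    (hFlh : KundtInfinity.LocallyHomogeneousOn hF V)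
    -- the splitting is adapted to the triple: the covectors in I^1 vanish along the fibres
    (hadapt : ∀ p ∈ KundtInfinity.productDomain B V, ∀ w ∈ T.I1 p, ∀ c, w (Sum.inr c) = 0) :
    ∃ S : ℝ, ∀ x ∈ KundtInfinity.productDomain B V,
      (∀ e : Fin k → Fin k → ℝ,
        KundtInfinity.IsOrthonormalFrame
          (Real.exp (2 * f (KundtInfinity.basePt x)) • hF (KundtInfinity.fiberPt x)) e →
        ∀ i j, ∑ a, ∑ b, T.s x (Sum.inr a) (Sum.inr b) * e i a * e j b
          = S * (if i = j then 1 else 0)) ∧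
      (∀ e : Fin m → Fin m → ℝ,
        KundtInfinity.IsOrthonormalFrame (hB (KundtInfinity.basePt x)) e →
        ∀ K I,
          -(∑ A, ∑ C, KundtInfinity.hessian hB f (KundtInfinity.basePt x) A C * e I A * e K C
            + (∑ A, e K A * KundtInfinity.pd A f (KundtInfinity.basePt x))
              * (∑ A, e I A * KundtInfinity.pd A f (KundtInfinity.basePt x)))
          = (S / 2) * (if K = I then 1 else 0)) := by
  -- The only possible constant is `S = 0`.
  refine ⟨0, fun x hx => ?_⟩
  have hle : T.I1 x ≤ T.calI x :=
    Submodule.span_mono (Set.subset_iUnion (fun r => T.valuesAt r x) 0)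
  have : NeZero k := ⟨by
    rintro rfl
    have h := Submodule.finrank_mono hle
    rw [hI1 x hx] at h
    have := (hI x hx).2
    omega⟩
  have : NeZero m := ⟨by
    rintro rfl
    have h := (hI x hx).1
    rw [KundtInfinity.KundtTriple.calI_eq_bot
      fun p hp => Submodule.finrank_eq_zero.1 (hI1 p hp), finrank_bot] at h
    exact lt_irrefl _ h⟩
  refine ⟨fun e _ i j => ?_, fun e _ K I => ?_⟩
  · simp [KundtInfinity.KundtTriple.s_fiber_eq_zero hBopen hVopen hwarp hBriem hFriem hf hI1
      hadapt hx]
  · have hpd : ∀ b ∈ B, ∀ A, KundtInfinity.pd A f b = 0 := fun b hb A =>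
      KundtInfinity.KundtTriple.pd_warping_eq_zero (x := Sum.elim b (KundtInfinity.fiberPt x))
        hBopen hVopen hwarp hFriem hf hI1 hadapt ⟨hb, hx.2⟩ A
    have hhess (A C : Fin m) : KundtInfinity.hessian hB f (KundtInfinity.basePt x) A C = 0 := by
      rw [KundtInfinity.hessian, KundtInfinity.covDeriv,
        KundtInfinity.pd_eq_zero hBopen hx.1 (fun b hb => hpd b hb A)]
      simp [hpd _ hx.1]
    simp [hhess, hpd _ hx.1]
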